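/- Let $a,\mu\in\mathbb{R}$ with $\mu>0$ and $a^2>2$, and let $f\colon\mathbb{R}\to\mathbb{R}$ be a continuous (for instance real analytic) $2\pi$-periodic function. For $c\ge 0$ consider the system $$\dot\varphi=p,\qquad \dot p=-\sin\varphi-\mu p-\frac{a^2}{4}\sin 2\varphi+c f(t)\cos\varphi ,$$ that is, the averaged equations of a pendulum with friction coefficient $\mu$, a rapidly vibrating pivot point and the horizontal force $F(t)=c f(t)$, where $\varphi=\pi$ is the upward vertical position. Then there are a number $c_0>0$ (depending on $a$, $\mu$ and $f$) and functions $x_c=(\varphi_c,p_c)\colon\mathbb{R}\to\mathbb{R}^2$, $c\in[0,c_0)$, such that: 1. for every $c\in[0,c_0)$, $x_c$ is a $2\pi$-periodic solution of the system with parameter $c$, and it is asymptotically stable, i.e. for every initial time $t_0$ it is Lyapunov stable and attracts all solutions whose values at $t_0$ are sufficiently close to $x_c(t_0)$; 2. for $c=0$ this solution is the upward vertical equilibrium: $x_0(t)=(\pi,0)$ for all $t$; 3. $x_c(t)$ depends continuously on $(c,t)\in[0,c_0)\times\mathbb{R}$. -/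

import Mathlib

open Set Filter Topology

/-- The right-hand side of the averaged pendulum system
`φ' = p`, `p' = - sin φ - μ p - (a² / 4) sin (2 φ) + F(t) cos φ`,
as a time-dependent vector field on the phase plane with points `(φ, p)`. The slow time `s`,
which obeys `s' = 1`, is the time `t`. The upward vertical equilibrium for `F = 0` is `(π, 0)`. -/
noncomputable def averagedPendulum (a μ : ℝ) (F : ℝ → ℝ) : ℝ → ℝ × ℝ → ℝ × ℝ :=
  fun t x => (x.2,
    - Real.sin x.1 - μ * x.2 - (a ^ 2 / 4) * Real.sin (2 * x.1) + F t * Real.cos x.1)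

/-- Lyapunov stability of the solution `x` of `x' = v t x`: for every initial time `t₀` and every
`ε > 0`, all solutions that start at time `t₀` sufficiently close to `x t₀` remain `ε`-close to `x`
for as long as they are defined. -/
def IsLyapunovStableSolution {E : Type*} [NormedAddCommGroup E] [NormedSpace ℝ E]
    (v : ℝ → E → E) (x : ℝ → E) : Prop :=
  ∀ t₀ : ℝ, ∀ ε > 0, ∃ δ > 0, ∀ (T : ℝ) (y : ℝ → E),
    IsIntegralCurveOn y v (Icc t₀ T) → ‖y t₀ - x t₀‖ < δ →
      ∀ t ∈ Icc t₀ T, ‖y t - x t‖ < ε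

/-- Attractivity of the solution `x` of `x' = v t x`: for every initial time `t₀`, all solutions
that start at time `t₀` sufficiently close to `x t₀` converge to `x` as time tends to infinity. -/
def IsAttractiveSolution {E : Type*} [NormedAddCommGroup E] [NormedSpace ℝ E]
    (v : ℝ → E → E) (x : ℝ → E) : Prop :=
  ∀ t₀ : ℝ, ∃ δ > 0, ∀ y : ℝ → E,
    IsIntegralCurveOn y v (Ici t₀) → ‖y t₀ - x t₀‖ < δ →
      Tendsto (fun t => ‖y t - x t‖) atTop (𝓝 0)

/-- `x` is an asymptotically stable solution, defined for all times, of `x' = v t x`. -/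
structure IsAsymptoticallyStableSolution {E : Type*} [NormedAddCommGroup E] [NormedSpace ℝ E]
    (v : ℝ → E → E) (x : ℝ → E) : Prop where
  isIntegralCurve : IsIntegralCurve x v
  stable : IsLyapunovStableSolution v x
  attractive : IsAttractiveSolution v x

/-! In the variable `u = φ - π` the system is `u'' + μ u' + k u = R` with `k = a² / 2 - 1`; the
hypothesis `a² > 2` says exactly that `k > 0`, so the linear part is a damped oscillator. The
remainder `R` has a small Lipschitz constant in `u` when `u` and the force are small
(`abs_pendulumRemainder_sub_le`).

Existence: the linear oscillator has a bounded solution operator on periodic functions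
(`exists_periodic_solution_operator`), so a periodic solution of the full equation is a fixed point
of a contraction on a small ball of periodic functions. The contraction constant is uniform in `c`,
which makes the fixed point Lipschitz in `c`; at `c = 0` the remainder vanishes at `u = 0`, so the
fixed point is zero.

Stability: the difference `w` of a solution and the periodic one satisfies `w'' + μ w' + k w = e`
with `|e| ≤ η |w|` near the equilibrium. An energy with a cross term in `w p`, which dissipates both
variables, then decays exponentially (`exists_damped_oscillator_decay`). -/

/-! ### Periodic solutions of the linear damped oscillator -/

/-- The convolution over one period that solves `y' = -l y + g` with `y` of period `T`. -/
noncomputable def periodicResponse (T : ℝ) (l : ℂ) (g : ℝ → ℂ) (t : ℝ) : ℂ :=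
  (1 - Complex.exp (-l * T))⁻¹ * ∫ r in (0 : ℝ)..T, Complex.exp (-l * r) * g (t - r)

theorem periodicResponse_periodic {T : ℝ} {l : ℂ} {g : ℝ → ℂ} (hg : Function.Periodic g T) :
    Function.Periodic (periodicResponse T l g) T := by
  intro t
  simp only [periodicResponse]
  congr 2
  ext r
  rw [show t + T - r = t - r + T by ring, hg]

theorem one_sub_exp_neg_mul_ne_zero {T : ℝ} (hT : 0 < T) {l : ℂ} (hl : 0 < l.re) :
    1 - Complex.exp (-l * T) ≠ 0 := by
  intro h
  have h1 : ‖Complex.exp (-l * T)‖ = 1 := by rw [← sub_eq_zero.mp h]; simp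
  rw [Complex.norm_exp, Real.exp_eq_one_iff] at h1
  simp at h1
  rcases h1 with h1 | h1 <;> linarith

/-- The substitution `s = t - r` turns the convolution into `exp (-l t)` times an integral of `exp
(l s) g s` over `[t - T, t]`. Periodicity of `g` makes the two endpoint terms combine to `(1 - exp
(-l T)) g t`, which the prefactor normalizes. -/
theorem periodicResponse_hasDerivAt {T : ℝ} (hT : 0 < T) {l : ℂ} (hl : 0 < l.re) {g : ℝ → ℂ}
    (hc : Continuous g) (hg : Function.Periodic g T) (t : ℝ) :
    HasDerivAt (periodicResponse T l g) (-l * periodicResponse T l g t + g t) t := by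
  have hne := one_sub_exp_neg_mul_ne_zero hT hl
  set k : ℝ → ℂ := fun s => Complex.exp (l * s) * g s with hk
  have hkc : Continuous k := by fun_prop
  have hint : ∀ x y : ℝ, IntervalIntegrable k MeasureTheory.volume x y :=
    fun x y => hkc.intervalIntegrable x y
  have hG : ∀ s : ℝ, HasDerivAt (fun u : ℝ => ∫ x in (0 : ℝ)..u, k x) (k s) s := fun s =>
    intervalIntegral.integral_hasDerivAt_right (hint 0 s)
      hkc.stronglyMeasurable.stronglyMeasurableAtFilter hkc.continuousAt
  have hrep : periodicResponse T l g = fun t : ℝ => (1 - Complex.exp (-l * T))⁻¹ *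
      (Complex.exp (-l * t) * ((∫ x in (0 : ℝ)..t, k x) - ∫ x in (0 : ℝ)..(t - T), k x)) := by
    ext t
    simp only [periodicResponse]
    congr 1
    rw [intervalIntegral.integral_interval_sub_left (hint _ _) (hint _ _),
      ← intervalIntegral.integral_const_mul]
    have h := intervalIntegral.integral_comp_sub_left
      (fun s : ℝ => Complex.exp (-l * t) * k s) (a := 0) (b := T) t
    rw [sub_zero] at h
    rw [← h]
    congr 1
    ext r
    simp only [hk]
    rw [← mul_assoc, ← Complex.exp_add]
    congr 2
    push_cast
    ring
  have hexp : HasDerivAt (fun t : ℝ => Complex.exp (-l * t)) (Complex.exp (-l * t) * -l) t := by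
    have h := ((Complex.ofRealCLM.hasDerivAt (x := t)).const_mul (-l)).cexp
    simpa using h
  have hshift : HasDerivAt (fun u : ℝ => ∫ x in (0 : ℝ)..(u - T), k x) (k (t - T)) t :=
    (hG (t - T)).comp_sub_const t T
  have hd := (hexp.mul ((hG t).sub hshift)).const_mul ((1 - Complex.exp (-l * T))⁻¹)
  rw [hrep]
  refine hd.congr_deriv ?_
  have h1 : Complex.exp (-l * t) * (k t - k (t - T)) = (1 - Complex.exp (-l * T)) * g t := by
    have e1 : Complex.exp (-l * t) * Complex.exp (l * t) = 1 := by
      rw [← Complex.exp_add]; simp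
    have e2 : Complex.exp (-l * t) * Complex.exp (l * ((t - T : ℝ) : ℂ))
        = Complex.exp (-l * T) := by
      rw [← Complex.exp_add]; congr 1; push_cast; ring
    simp only [hk, hg.sub_eq]
    linear_combination g t * e1 - g t * e2
  simp only [Pi.sub_apply]
  rw [h1]
  linear_combination g t * inv_mul_cancel₀ hne

theorem norm_periodicResponse_sub_le {T : ℝ} (hT : 0 < T) {l : ℂ} (hl : 0 < l.re) {g h : ℝ → ℂ}
    (hg : Continuous g) (hh : Continuous h) {M : ℝ} (hM : ∀ t, ‖g t - h t‖ ≤ M) (t : ℝ) :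
    ‖periodicResponse T l g t - periodicResponse T l h t‖
      ≤ ‖(1 - Complex.exp (-l * T))⁻¹‖ * T * M := by
  simp only [periodicResponse]
  rw [← mul_sub, ← intervalIntegral.integral_sub
    (Continuous.intervalIntegrable (by fun_prop) _ _)
    (Continuous.intervalIntegrable (by fun_prop) _ _), norm_mul, mul_assoc]
  refine mul_le_mul_of_nonneg_left ?_ (norm_nonneg _)
  have h := intervalIntegral.norm_integral_le_of_norm_le_const (a := 0) (b := T) (C := M)
    (f := fun r : ℝ => Complex.exp (-l * r) * g (t - r) - Complex.exp (-l * r) * h (t - r)) ?_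
  · rwa [sub_zero, abs_of_pos hT, mul_comm] at h
  intro r hr
  rw [uIoc_of_le hT.le] at hr
  rw [← mul_sub, norm_mul, Complex.norm_exp]
  have he : Real.exp (-l * r).re ≤ 1 := by
    rw [Real.exp_le_one_iff]
    simp only [Complex.mul_re, Complex.neg_re, Complex.ofReal_re, Complex.ofReal_im]
    nlinarith [hr.1]
  calc _ ≤ 1 * M := mul_le_mul he (hM _) (norm_nonneg _) zero_le_one
    _ = M := one_mul M

/-- Factors the oscillator as `(D + l₁) (D + l₂)`, `D = d/dt`. The roots may be complex, hence the
detour through complex-valued functions. -/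
theorem exists_roots_re_pos {m k : ℝ} (hm : 0 < m) (hk : 0 < k) :
    ∃ l₁ l₂ : ℂ, 0 < l₁.re ∧ 0 < l₂.re ∧ l₁ + l₂ = m ∧ l₁ * l₂ = k := by
  obtain ⟨d, hd⟩ := IsAlgClosed.exists_pow_nat_eq ((m ^ 2 - 4 * k : ℝ) : ℂ) (n := 2) two_pos
  have hre : |d.re| < m := by
    have h1 := congrArg Complex.re hd
    have h2 := congrArg Complex.im hd
    simp only [pow_two, Complex.mul_re, Complex.mul_im, Complex.ofReal_re, Complex.ofReal_im]
      at h1 h2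
    have h3 : d.re * d.im = 0 := by linarith
    -- The discriminant is real, so its square root is imaginary, or real with square less than
    -- `m²`.
    rcases mul_eq_zero.mp h3 with h | h
    · rw [h]; simpa using hm
    · rw [h] at h1
      exact abs_lt_of_sq_lt_sq (by nlinarith) hm.le
  rw [abs_lt] at hre
  refine ⟨(m + d) / 2, (m - d) / 2, ?_, ?_, by ring, ?_⟩
  · simp; linarith
  · simp; linarith
  · push_cast at hd
    linear_combination -hd / 4

/-- The bounded linear solution operator of `u'' + m u' + k u = g` on functions of period `T`,
with values the solution and its derivative. -/
theorem exists_periodic_solution_operator {T m k : ℝ} (hT : 0 < T) (hm : 0 < m) (hk : 0 < k) :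
    ∃ C > 0, ∃ U P : (ℝ → ℝ) → ℝ → ℝ, (∀ t, U 0 t = 0) ∧ (∀ t, P 0 t = 0) ∧
      (∀ g, Continuous g → Function.Periodic g T →
        Function.Periodic (U g) T ∧ Function.Periodic (P g) T ∧
        (∀ t, HasDerivAt (U g) (P g t) t) ∧
        (∀ t, HasDerivAt (P g) (-k * U g t - m * P g t + g t) t)) ∧
      (∀ g h, Continuous g → Continuous h → Function.Periodic g T → Function.Periodic h T →
        ∀ M, (∀ t, |g t - h t| ≤ M) →
          ∀ t, |U g t - U h t| ≤ C * M ∧ |P g t - P h t| ≤ C * M) := by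
  obtain ⟨l₁, l₂, h₁, h₂, hsum, hprod⟩ := exists_roots_re_pos hm hk
  set c₁ := ‖(1 - Complex.exp (-l₁ * T))⁻¹‖ * T with hc₁
  set c₂ := ‖(1 - Complex.exp (-l₂ * T))⁻¹‖ * T with hc₂
  have hc₁0 : 0 ≤ c₁ := by positivity
  have hc₂0 : 0 ≤ c₂ := by positivity
  -- Two first-order equations in succession: `z' + l₂ z = g`, then `w' + l₁ w = z`. The solution is
  -- the real part of `w`.
  set z : (ℝ → ℝ) → ℝ → ℂ := fun g => periodicResponse T l₂ (fun t => (g t : ℂ)) with hz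
  set w : (ℝ → ℝ) → ℝ → ℂ := fun g => periodicResponse T l₁ (z g) with hw
  have hz0 : z 0 = 0 := by ext t; simp [hz, periodicResponse]
  have hw0 : w 0 = 0 := by ext t; simp [hw, hz0, periodicResponse]
  have hzd : ∀ g, Continuous g → Function.Periodic g T →
      ∀ t, HasDerivAt (z g) (-l₂ * z g t + g t) t := fun g hg hp t =>
    periodicResponse_hasDerivAt hT h₂ (g := fun t => (g t : ℂ)) (by fun_prop)
      (fun t => by simp [hp t]) t
  have hzp : ∀ g, Function.Periodic g T → Function.Periodic (z g) T := fun g hp =>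
    periodicResponse_periodic (fun t => by simp [hp t])
  have hzc : ∀ g, Continuous g → Function.Periodic g T → Continuous (z g) := fun g hg hp =>
    continuous_iff_continuousAt.mpr fun t => (hzd g hg hp t).continuousAt
  have hwd : ∀ g, Continuous g → Function.Periodic g T →
      ∀ t, HasDerivAt (w g) (-l₁ * w g t + z g t) t := fun g hg hp t =>
    periodicResponse_hasDerivAt hT h₁ (hzc g hg hp) (hzp g hp) t
  have hwp : ∀ g, Function.Periodic g T → Function.Periodic (w g) T := fun g hp =>
    periodicResponse_periodic (hzp g hp)
  have hre : ∀ {F : ℝ → ℂ} {F' : ℂ} {t : ℝ}, HasDerivAt F F' t →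
      HasDerivAt (fun t => (F t).re) F'.re t := fun {F F' t} h => by
    exact Complex.reCLM.hasFDerivAt.comp_hasDerivAt t h
  refine ⟨c₁ * c₂ + (c₂ + ‖l₁‖ * (c₁ * c₂)) + 1, by positivity, fun g t => (w g t).re,
    fun g t => (-l₁ * w g t + z g t).re, by simp [hw0], by simp [hw0, hz0], ?_, ?_⟩
  · intro g hg hp
    refine ⟨fun t => by simp [hwp g hp t], fun t => by simp only [hwp g hp t, hzp g hp t],
      fun t => hre (hwd g hg hp t), fun t => ?_⟩
    have h := hre (((hwd g hg hp t).const_mul (-l₁)).add (hzd g hg hp t))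
    refine h.congr_deriv ?_
    have e : -l₁ * (-l₁ * w g t + z g t) + (-l₂ * z g t + g t)
        = ((-k : ℝ) : ℂ) * w g t - (m : ℂ) * (-l₁ * w g t + z g t) + (g t : ℂ) := by
      push_cast
      rw [← hsum, ← hprod]
      ring
    rw [e]
    simp only [Complex.add_re, Complex.sub_re, Complex.re_ofReal_mul, Complex.ofReal_re]
  · intro g h hg hh hgp hhp M hM t
    have hM0 : 0 ≤ M := (abs_nonneg _).trans (hM 0)
    have ez : ∀ t, ‖z g t - z h t‖ ≤ c₂ * M :=
      norm_periodicResponse_sub_le hT h₂ (by fun_prop) (by fun_prop) fun t => by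
        rw [← Complex.ofReal_sub, Complex.norm_real]; exact hM t
    have ew : ‖w g t - w h t‖ ≤ c₁ * (c₂ * M) :=
      norm_periodicResponse_sub_le hT h₁ (hzc g hg hgp) (hzc h hh hhp) ez t
    have n1 : 0 ≤ c₁ * c₂ * M := by positivity
    have n2 : 0 ≤ c₂ * M := by positivity
    have n3 : 0 ≤ ‖l₁‖ * (c₁ * c₂) * M := by positivity
    constructor
    · rw [← Complex.sub_re]
      refine (Complex.abs_re_le_norm _).trans (ew.trans ?_)
      linarith
    · rw [← Complex.sub_re]
      refine (Complex.abs_re_le_norm _).trans ?_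
      have e : -l₁ * w g t + z g t - (-l₁ * w h t + z h t)
          = (z g t - z h t) - l₁ * (w g t - w h t) := by ring
      rw [e]
      refine (norm_sub_le _ _).trans ?_
      rw [norm_mul]
      have := mul_le_mul_of_nonneg_left ew (norm_nonneg l₁)
      linarith [ez t]

/-! ### Periodic solutions of the nonlinear equation by contraction -/

open scoped BoundedContinuousFunction in
/-- A nonlinear perturbation of small Lipschitz constant of a bounded solution operator `U` for
functions of period `T` has a periodic solution in a small ball. -/
theorem exists_periodic_fixedPoint {T : ℝ} {U : (ℝ → ℝ) → ℝ → ℝ} {C r q e : ℝ}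
    (hq : 0 ≤ q) (hr : 0 ≤ r) (hU0 : ∀ t, U 0 t = 0)
    (hU : ∀ g, Continuous g → Function.Periodic g T →
      Continuous (U g) ∧ Function.Periodic (U g) T)
    (hUL : ∀ g h, Continuous g → Continuous h → Function.Periodic g T → Function.Periodic h T →
      ∀ M, (∀ t, |g t - h t| ≤ M) → ∀ t, |U g t - U h t| ≤ C * M)
    {N : ℝ → ℝ → ℝ} (hN : Continuous fun z : ℝ × ℝ => N z.1 z.2)
    (hNp : ∀ t u, N (t + T) u = N t u)
    (hNL : ∀ t u v, |u| ≤ r → |v| ≤ r → |N t u - N t v| ≤ q * |u - v|)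
    (hN0 : ∀ t, |N t 0| ≤ e) (hCq : C * q ≤ 1 / 2) (hCe : C * e ≤ r / 2) :
    ∃ u : ℝ →ᵇ ℝ, Function.Periodic u T ∧ (∀ t, |u t| ≤ r) ∧
      ∀ t, U (fun s => N s (u s)) t = u t := by
  set S : Set (ℝ →ᵇ ℝ) := {u | Function.Periodic u T ∧ ∀ t, |u t| ≤ r} with hS
  have hSc : IsClosed S := by
    have h1 : S = (⋂ t : ℝ, {u : ℝ →ᵇ ℝ | u (t + T) = u t}) ∩
        ⋂ t : ℝ, {u : ℝ →ᵇ ℝ | |u t| ≤ r} := by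
      ext u; simp [hS, Function.Periodic]
    rw [h1]
    refine (isClosed_iInter fun t => ?_).inter (isClosed_iInter fun t => ?_)
    · exact isClosed_eq (BoundedContinuousFunction.lipschitz_eval_const _).continuous
        (BoundedContinuousFunction.lipschitz_eval_const _).continuous
    · exact isClosed_le (BoundedContinuousFunction.lipschitz_eval_const t).continuous.abs continuous_const
  have : CompleteSpace S := hSc.completeSpace_coe
  have : Nonempty S := ⟨⟨0, fun t => rfl, fun t => by simpa using hr⟩⟩
  have hcont : ∀ u : S, Continuous fun s => N s (u.1 s) := fun u =>
    hN.comp (continuous_id.prodMk u.1.continuous)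
  have hper : ∀ u : S, Function.Periodic (fun s => N s (u.1 s)) T := fun u s => by
    simp only [u.2.1 s, hNp]
  -- The ball is mapped into itself: `C (q r + e) ≤ r / 2 + r / 2`.
  have hbd : ∀ (u : S) t, |U (fun s => N s (u.1 s)) t| ≤ r := fun u t => by
    have h := hUL _ 0 (hcont u) continuous_const (hper u) (fun _ => rfl) (q * r + e) (fun s => by
      have h1 := hNL s (u.1 s) 0 (u.2.2 s) (by simpa using hr)
      have h2 := mul_le_mul_of_nonneg_left (u.2.2 s) hq
      have h3 := abs_add_le (N s (u.1 s) - N s 0) (N s 0)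
      rw [sub_zero] at h1
      rw [sub_add_cancel] at h3
      simp only [Pi.zero_apply, sub_zero]
      linarith [hN0 s]) t
    rw [hU0, sub_zero] at h
    have := mul_le_mul_of_nonneg_right hCq hr
    linarith
  let Φ : S → S := fun u =>
    ⟨BoundedContinuousFunction.ofNormedAddCommGroup (U fun s => N s (u.1 s))
      (hU _ (hcont u) (hper u)).1 r (hbd u), (hU _ (hcont u) (hper u)).2, hbd u⟩
  have hΦ : ContractingWith (1 / 2) Φ := by
    refine ⟨by norm_num, LipschitzWith.of_dist_le_mul fun u v => ?_⟩
    rw [Subtype.dist_eq, Subtype.dist_eq, BoundedContinuousFunction.dist_le (by positivity)]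
    intro t
    refine (hUL _ _ (hcont u) (hcont v) (hper u) (hper v) (q * dist u.1 v.1) (fun s => ?_)
      t).trans ?_
    · exact (hNL s _ _ (u.2.2 s) (v.2.2 s)).trans
        (mul_le_mul_of_nonneg_left ((Real.dist_eq _ _).symm.trans_le
          (BoundedContinuousFunction.dist_coe_le_dist (f := u.1) (g := v.1) s)) hq)
    · rw [← mul_assoc]
      refine (mul_le_mul_of_nonneg_right hCq dist_nonneg).trans_eq ?_
      simp
  refine ⟨(ContractingWith.fixedPoint Φ hΦ).1, (ContractingWith.fixedPoint Φ hΦ).2.1,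
    (ContractingWith.fixedPoint Φ hΦ).2.2, fun t => ?_⟩
  have h := hΦ.fixedPoint_isFixedPt
  exact congrArg (fun u : S => u.1 t) h

/-! ### Energy estimates and exponential stability -/

/-- The energy `(p + m w / 2) ^ 2 + (k + m ^ 2 / 4) w ^ 2` of `w'' + m w' + k w = e` is dissipated
when `e` is small relative to `w`. -/
theorem oscillator_dissipation_le {m k η w p e : ℝ} (hm : 0 < m) (hη : 0 ≤ η) (hη1 : η ≤ m / 2)
    (hη2 : η * (1 + m) ≤ m * k / 2) (he : |e| ≤ η * |w|) :
    -m * p ^ 2 - m * k * w ^ 2 + (2 * p + m * w) * e ≤ -(m / 2) * (p ^ 2 + k * w ^ 2) := by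
  have h1 : (2 * p + m * w) * e ≤ (2 * |p| + m * |w|) * (η * |w|) := by
    refine (le_abs_self _).trans ?_
    rw [abs_mul]
    refine mul_le_mul ((abs_add_le _ _).trans_eq ?_) he (abs_nonneg _) (by positivity)
    rw [abs_mul, abs_mul, abs_of_pos hm, abs_two]
  have h2 : (2 * |p| + m * |w|) * (η * |w|)
      = η * (|p| ^ 2 + (1 + m) * |w| ^ 2) - η * (|p| - |w|) ^ 2 := by ring
  rw [sq_abs p, sq_abs w] at h2
  have h3 := mul_le_mul_of_nonneg_right hη1 (sq_nonneg p)
  have h4 := mul_le_mul_of_nonneg_right hη2 (sq_nonneg w)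
  have h5 := mul_nonneg hη (sq_nonneg (|p| - |w|))
  linarith

/-- Converts the dissipation rate, a multiple of `p ^ 2 + k * w ^ 2`, into a multiple of the energy
itself. -/
theorem oscillator_energy_le {m k : ℝ} (hk : 0 < k) (w p : ℝ) :
    (p + m / 2 * w) ^ 2 + (k + m ^ 2 / 4) * w ^ 2
      ≤ (3 + m ^ 2 / k) * (p ^ 2 + k * w ^ 2) := by
  have h1 : (3 + m ^ 2 / k) * (p ^ 2 + k * w ^ 2)
      = 3 * p ^ 2 + m ^ 2 / k * p ^ 2 + (3 * k + m ^ 2) * w ^ 2 := by field_simp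
  have h2 : 0 ≤ m ^ 2 / k * p ^ 2 := by positivity
  rw [h1]
  linarith [sq_nonneg (p - m / 2 * w), mul_nonneg hk.le (sq_nonneg w), sq_nonneg p,
    mul_nonneg (sq_nonneg m) (sq_nonneg w)]

theorem oscillator_energy_le_of_abs_le {m k δ w p : ℝ} (hk : 0 < k) (hw : |w| ≤ δ) (hp : |p| ≤ δ) :
    (p + m / 2 * w) ^ 2 + (k + m ^ 2 / 4) * w ^ 2 ≤ (2 + k + m ^ 2) * δ ^ 2 := by
  have h1 : w ^ 2 ≤ δ ^ 2 := sq_le_sq' (abs_le.mp hw).1 (abs_le.mp hw).2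
  have h2 : p ^ 2 ≤ δ ^ 2 := sq_le_sq' (abs_le.mp hp).1 (abs_le.mp hp).2
  have h3 := mul_le_mul_of_nonneg_left h1 (by positivity : 0 ≤ k + m ^ 2)
  linarith [sq_nonneg (p - m / 2 * w), mul_nonneg (sq_nonneg m) (sq_nonneg w)]

theorem sq_le_oscillator_energy {m k : ℝ} (hk : 0 < k) (w p : ℝ) :
    w ^ 2 ≤ (2 + 1 / k) * ((p + m / 2 * w) ^ 2 + (k + m ^ 2 / 4) * w ^ 2) ∧
    p ^ 2 ≤ (2 + 1 / k) * ((p + m / 2 * w) ^ 2 + (k + m ^ 2 / 4) * w ^ 2) := by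
  have hk' : 0 < 1 / k := one_div_pos.mpr hk
  set E := (p + m / 2 * w) ^ 2 + (k + m ^ 2 / 4) * w ^ 2 with hE
  have hkw : k * w ^ 2 ≤ E := by
    rw [hE]
    linarith [sq_nonneg (p + m / 2 * w), mul_nonneg (sq_nonneg m) (sq_nonneg w)]
  have hp : p ^ 2 ≤ 2 * E := by
    rw [hE]
    linarith [sq_nonneg (p + m * w), mul_nonneg hk.le (sq_nonneg w)]
  have hE0 : 0 ≤ E := (by positivity : 0 ≤ k * w ^ 2).trans hkw
  have h1 : w ^ 2 ≤ 1 / k * E := by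
    rw [one_div, inv_mul_eq_div, le_div_iff₀ hk]
    linarith
  have h2 := mul_nonneg hk'.le hE0
  constructor <;> linarith

/-- Solutions of `w'' + m w' + k w = e` with an error term `e` that is small relative to `w` as long
as `|w| ≤ r` decay exponentially if they start close to zero. -/
theorem exists_damped_oscillator_decay {m k : ℝ} (hm : 0 < m) (hk : 0 < k) :
    ∃ η > 0, ∃ β > 0, ∃ K > 0, ∀ (r t₀ T : ℝ) (w p e : ℝ → ℝ),
      (∀ t ∈ Icc t₀ T, HasDerivWithinAt w (p t) (Icc t₀ T) t) →
      (∀ t ∈ Icc t₀ T, HasDerivWithinAt p (-k * w t - m * p t + e t) (Icc t₀ T) t) →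
      (∀ t ∈ Icc t₀ T, |w t| ≤ r → |e t| ≤ η * |w t|) →
      ∀ δ > 0, K * δ ≤ r → |w t₀| ≤ δ → |p t₀| ≤ δ → ∀ t ∈ Icc t₀ T,
        |w t| ≤ K * δ * Real.exp (-β * (t - t₀)) ∧ |p t| ≤ K * δ * Real.exp (-β * (t - t₀)) := by
  set η := min (m / 2) (m * k / (2 * (1 + m))) with hη
  have hη0 : 0 < η := by positivity
  have hη1 : η ≤ m / 2 := min_le_left _ _
  have hη2 : η * (1 + m) ≤ m * k / 2 := by
    have h : η ≤ m * k / (2 * (1 + m)) := min_le_right _ _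
    rw [le_div_iff₀ (by positivity)] at h
    linarith
  set A := 3 + m ^ 2 / k with hA
  have hA0 : 0 < A := by positivity
  set A' := 2 + k + m ^ 2 with hA'
  have hA'0 : 0 < A' := by positivity
  set L := 2 + 1 / k with hL
  have hL0 : 0 < L := by positivity
  -- This gives dissipation at rate `4 * β`, twice what is claimed; the slack yields the strict
  -- inequality needed for the comparison argument.
  set β := m / (8 * A) with hβ
  have hβ0 : 0 < β := by positivity
  have hβA : 4 * β * A = m / 2 := by rw [hβ]; field_simp; norm_num
  set K := 1 + L * A' with hK
  have hK0 : 0 < K := by positivity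
  have hKL : L * A' ≤ K ^ 2 := by nlinarith [mul_pos hL0 hA'0]
  refine ⟨η, hη0, β, hβ0, K, hK0, fun r t₀ T w p e hw hp he δ hδ hKr hw0 hp0 => ?_⟩
  set V : ℝ → ℝ := fun t => (p t + m / 2 * w t) ^ 2 + (k + m ^ 2 / 4) * w t ^ 2 with hV
  have hVl : ∀ t, w t ^ 2 ≤ L * V t ∧ p t ^ 2 ≤ L * V t := fun t =>
    sq_le_oscillator_energy hk (w t) (p t)
  have hVd : ∀ t ∈ Icc t₀ T, HasDerivWithinAt V
      (-m * p t ^ 2 - m * k * w t ^ 2 + (2 * p t + m * w t) * e t) (Icc t₀ T) t := fun t ht => by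
    have h := (((hp t ht).add ((hw t ht).const_mul (m / 2))).pow 2).add
      (((hw t ht).pow 2).const_mul (k + m ^ 2 / 4))
    refine h.congr_deriv ?_
    simp only [Pi.add_apply, Nat.cast_ofNat]
    ring
  have hdec : ∀ t ∈ Icc t₀ T, |w t| ≤ r → 0 < V t →
      -m * p t ^ 2 - m * k * w t ^ 2 + (2 * p t + m * w t) * e t < -(2 * β) * V t := by
    intro t ht hwr hVt
    have h1 := oscillator_dissipation_le (p := p t) hm hη0.le hη1 hη2 (he t ht hwr)
    have h2 : 4 * β * V t ≤ 4 * β * (A * (p t ^ 2 + k * w t ^ 2)) :=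
      mul_le_mul_of_nonneg_left (oscillator_energy_le hk (w t) (p t)) (by positivity)
    rw [← mul_assoc, hβA] at h2
    linarith [mul_pos hβ0 hVt]
  have hB : ∀ t, HasDerivAt (fun t => A' * δ ^ 2 * Real.exp (-(2 * β) * (t - t₀)))
      (-(2 * β) * (A' * δ ^ 2 * Real.exp (-(2 * β) * (t - t₀)))) t := fun t => by
    have h := ((((hasDerivAt_id t).sub_const t₀).const_mul (-(2 * β))).exp).const_mul (A' * δ ^ 2)
    refine h.congr_deriv ?_
    simp only [id]
    ring
  have hsq : ∀ t, L * (A' * δ ^ 2 * Real.exp (-(2 * β) * (t - t₀)))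
      ≤ (K * δ * Real.exp (-β * (t - t₀))) ^ 2 := fun t => by
    have h : Real.exp (-(2 * β) * (t - t₀)) = Real.exp (-β * (t - t₀)) ^ 2 := by
      rw [← Real.exp_nat_mul]; congr 1; push_cast; ring
    rw [h, mul_pow, mul_pow, ← mul_assoc, ← mul_assoc]
    gcongr
  have hVB : ∀ ⦃t⦄, t ∈ Icc t₀ T → V t ≤ A' * δ ^ 2 * Real.exp (-(2 * β) * (t - t₀)) := by
    -- Derivatives are compared only where `V` equals the barrier. There the barrier itself gives
    -- `|w| ≤ r`, so the bound on `e` is available without an a priori estimate.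
    refine image_le_of_deriv_right_lt_deriv_boundary (fun t ht => (hVd t ht).continuousWithinAt)
      (fun t ht => (hVd t (Ico_subset_Icc_self ht)).mono_of_mem_nhdsWithin
        (Icc_mem_nhdsGE_of_mem ht)) ?_ hB ?_
    · simpa using oscillator_energy_le_of_abs_le (m := m) hk hw0 hp0
    · intro t ht hVt
      have ht' := Ico_subset_Icc_self ht
      have hpos : 0 < V t := by rw [hVt]; positivity
      rw [← hVt]
      refine hdec t ht' ?_ hpos
      have h1 := (hVl t).1
      rw [hVt] at h1
      refine (abs_le_of_sq_le_sq (h1.trans (hsq t)) (by positivity)).trans (le_trans ?_ hKr)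
      refine mul_le_of_le_one_right (by positivity) (Real.exp_le_one_iff.mpr ?_)
      nlinarith [ht.1]
  intro t ht
  have h := (mul_le_mul_of_nonneg_left (hVB ht) hL0.le).trans (hsq t)
  exact ⟨abs_le_of_sq_le_sq ((hVl t).1.trans h) (by positivity),
    abs_le_of_sq_le_sq ((hVl t).2.trans h) (by positivity)⟩

/-- A solution that attracts all nearby solutions exponentially is asymptotically stable. -/
theorem isAsymptoticallyStableSolution_of_exp_decay {E : Type*} [NormedAddCommGroup E]
    [NormedSpace ℝ E] {v : ℝ → E → E} {x : ℝ → E} {K r β : ℝ} (hx : IsIntegralCurve x v)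
    (hK : 0 < K) (hr : 0 < r) (hβ : 0 < β)
    (h : ∀ (t₀ T : ℝ) (y : ℝ → E), IsIntegralCurveOn y v (Icc t₀ T) → ∀ δ > 0, K * δ ≤ r →
      ‖y t₀ - x t₀‖ ≤ δ → ∀ t ∈ Icc t₀ T, ‖y t - x t‖ ≤ K * δ * Real.exp (-β * (t - t₀))) :
    IsAsymptoticallyStableSolution v x := by
  refine ⟨hx, fun t₀ ε hε => ?_, fun t₀ => ?_⟩
  · have hδ : 0 < min r (ε / 2) / K := by positivity
    have hKδ : K * (min r (ε / 2) / K) = min r (ε / 2) := by field_simp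
    refine ⟨min r (ε / 2) / K, hδ, fun T y hy hy0 t ht => ?_⟩
    have h1 := h t₀ T y hy _ hδ (hKδ.le.trans (min_le_left _ _)) hy0.le t ht
    rw [hKδ] at h1
    refine h1.trans_lt (lt_of_le_of_lt (mul_le_of_le_one_right (by positivity) ?_)
      ((min_le_right r (ε / 2)).trans_lt (by linarith)))
    rw [Real.exp_le_one_iff]
    nlinarith [ht.1]
  · have hKδ : K * (r / K) = r := by field_simp
    refine ⟨r / K, by positivity, fun y hy hy0 => ?_⟩
    have hlim : Tendsto (fun t : ℝ => K * (r / K) * Real.exp (-β * (t - t₀))) atTop (𝓝 0) := by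
      have h1 : Tendsto (fun t : ℝ => -β * (t - t₀)) atTop atBot :=
        (tendsto_atTop_add_const_right _ (-t₀) tendsto_id).const_mul_atTop_of_neg (by linarith)
      simpa using (Real.tendsto_exp_atBot.comp h1).const_mul (K * (r / K))
    refine squeeze_zero' (Eventually.of_forall fun t => norm_nonneg _) ?_ hlim
    filter_upwards [eventually_ge_atTop t₀] with t ht
    exact h t₀ t y (hy.mono Icc_subset_Ici_self) _ (by positivity) hKδ.le hy0.le t ⟨ht, le_rfl⟩

/-! ### The pendulum near the upward position -/

/-- The nonlinear part at the upward vertical position, in the variable `u = φ - π`, of the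
acceleration of the averaged pendulum under the horizontal force `b`. -/
noncomputable def pendulumRemainder (a b u : ℝ) : ℝ :=
  Real.sin u - a ^ 2 / 4 * Real.sin (2 * u) + (a ^ 2 / 2 - 1) * u - b * Real.cos u

theorem pendulumRemainder_zero (a b : ℝ) : pendulumRemainder a b 0 = -b := by
  simp [pendulumRemainder]

theorem continuous_pendulumRemainder (a : ℝ) :
    Continuous fun z : ℝ × ℝ => pendulumRemainder a z.1 z.2 := by
  unfold pendulumRemainder
  fun_prop

theorem abs_pendulumRemainder_sub_force_le (a b b' u : ℝ) :
    |pendulumRemainder a b u - pendulumRemainder a b' u| ≤ |b - b'| := by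
  have h : pendulumRemainder a b u - pendulumRemainder a b' u = -((b - b') * Real.cos u) := by
    unfold pendulumRemainder; ring
  rw [h, abs_neg, abs_mul]
  exact mul_le_of_le_one_right (abs_nonneg _) (Real.abs_cos_le_one u)

/-- Mean value inequality: without force the derivative in `u` vanishes at `0` and is bounded by `(1
+ a ^ 2) * R` on the interval; the force adds at most `|b|`. -/
theorem abs_pendulumRemainder_sub_le (a b : ℝ) {R u v : ℝ} (hu : |u| ≤ R) (hv : |v| ≤ R) :
    |pendulumRemainder a b u - pendulumRemainder a b v| ≤ ((1 + a ^ 2) * R + |b|) * |u - v| := by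
  have hd : ∀ x ∈ Icc (-R) R, HasDerivWithinAt (pendulumRemainder a b)
      ((Real.cos x - 1) - a ^ 2 / 2 * (Real.cos (2 * x) - 1) + b * Real.sin x) (Icc (-R) R) x := by
    intro x _
    have h2 : HasDerivAt (fun y : ℝ => Real.sin (2 * y)) (Real.cos (2 * x) * (2 * 1)) x :=
      ((hasDerivAt_id x).const_mul 2).sin
    have h := ((((Real.hasDerivAt_sin x).sub (h2.const_mul (a ^ 2 / 4))).add
      ((hasDerivAt_id x).const_mul (a ^ 2 / 2 - 1))).sub ((Real.hasDerivAt_cos x).const_mul b))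
    refine HasDerivAt.hasDerivWithinAt (h.congr_deriv ?_)
    ring
  have hb : ∀ x ∈ Icc (-R) R,
      ‖(Real.cos x - 1) - a ^ 2 / 2 * (Real.cos (2 * x) - 1) + b * Real.sin x‖
        ≤ (1 + a ^ 2) * R + |b| := by
    intro x hx
    have hx' : |x| ≤ R := abs_le.mpr hx
    have h1 : |Real.cos x - 1| ≤ |x| := by simpa using Real.abs_cos_sub_cos_le x 0
    have h2 : |Real.cos (2 * x) - 1| ≤ 2 * |x| := by
      simpa [abs_mul] using Real.abs_cos_sub_cos_le (2 * x) 0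
    have h3 : |a ^ 2 / 2 * (Real.cos (2 * x) - 1)| ≤ a ^ 2 * R := by
      rw [abs_mul, abs_of_nonneg (by positivity : 0 ≤ a ^ 2 / 2)]
      calc a ^ 2 / 2 * |Real.cos (2 * x) - 1| ≤ a ^ 2 / 2 * (2 * R) := by gcongr; linarith
        _ = a ^ 2 * R := by ring
    have h4 : |b * Real.sin x| ≤ |b| := by
      rw [abs_mul]; exact mul_le_of_le_one_right (abs_nonneg _) (Real.abs_sin_le_one x)
    rw [Real.norm_eq_abs]
    refine (abs_add_le _ _).trans ?_
    have h5 := abs_sub (Real.cos x - 1) (a ^ 2 / 2 * (Real.cos (2 * x) - 1))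
    linarith
  simpa [Real.norm_eq_abs] using (convex_Icc (-R) R).norm_image_sub_le_of_norm_hasDerivWithin_le
    hd hb (abs_le.mp hv) (abs_le.mp hu)

theorem averagedPendulum_eq (a μ : ℝ) (F : ℝ → ℝ) (t : ℝ) (y : ℝ × ℝ) :
    averagedPendulum a μ F t y = (y.2, -(a ^ 2 / 2 - 1) * (y.1 - Real.pi) - μ * y.2
      + pendulumRemainder a (F t) (y.1 - Real.pi)) := by
  unfold averagedPendulum pendulumRemainder
  have h : Real.sin (2 * (y.1 - Real.pi)) = Real.sin (2 * y.1) := by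
    rw [mul_sub, Real.sin_sub_two_pi]
  rw [h, Real.sin_sub_pi, Real.cos_sub_pi]
  ext <;> simp only
  ring

/-- A solution of the averaged pendulum that stays near the upward vertical position, under a small
force, is asymptotically stable. -/
theorem exists_averagedPendulum_stable {a μ : ℝ} (hμ : 0 < μ) (ha : 2 < a ^ 2) :
    ∃ η > 0, ∀ r > 0, ∀ (F : ℝ → ℝ) (x : ℝ → ℝ × ℝ),
      (∀ t, (1 + a ^ 2) * (2 * r) + |F t| ≤ η) → (∀ t, |(x t).1 - Real.pi| ≤ r) →
      IsIntegralCurve x (averagedPendulum a μ F) →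
      IsAsymptoticallyStableSolution (averagedPendulum a μ F) x := by
  have hk : 0 < a ^ 2 / 2 - 1 := by linarith
  obtain ⟨η, hη, β, hβ, K, hK, hdecay⟩ := exists_damped_oscillator_decay hμ hk
  refine ⟨η, hη, fun r hr F x hF hxr hx => ?_⟩
  refine isAsymptoticallyStableSolution_of_exp_decay hx hK hr hβ
    fun t₀ T y hy δ hδ hKδ hy0 t ht => ?_
  have hfst : ∀ s, |(y s).1 - (x s).1| ≤ ‖y s - x s‖ := fun s => norm_fst_le (y s - x s)
  have hsnd : ∀ s, |(y s).2 - (x s).2| ≤ ‖y s - x s‖ := fun s => norm_snd_le (y s - x s)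
  have key := hdecay r t₀ T (fun s => (y s).1 - (x s).1) (fun s => (y s).2 - (x s).2)
    (fun s => pendulumRemainder a (F s) ((y s).1 - Real.pi)
      - pendulumRemainder a (F s) ((x s).1 - Real.pi)) ?_ ?_ ?_ δ hδ hKδ
    ((hfst t₀).trans hy0) ((hsnd t₀).trans hy0) t ht
  · rw [Prod.norm_def]
    exact max_le key.1 key.2
  · intro s hs
    have h := (ContinuousLinearMap.fst ℝ ℝ ℝ).hasFDerivAt.comp_hasDerivWithinAt s
      ((hy s hs).sub (hx s).hasDerivWithinAt)
    simp only [averagedPendulum_eq] at h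
    exact h
  · intro s hs
    have h := (ContinuousLinearMap.snd ℝ ℝ ℝ).hasFDerivAt.comp_hasDerivWithinAt s
      ((hy s hs).sub (hx s).hasDerivWithinAt)
    refine h.congr_deriv ?_
    simp only [averagedPendulum_eq, ContinuousLinearMap.coe_snd', Prod.snd_sub]
    ring
  · intro s _ hws
    -- The reference solution is within `r` of `π` and `y` within `r` of it, hence the radius `2 *
    -- r` in the smallness condition.
    have h1 : |(y s).1 - Real.pi| ≤ 2 * r := by
      have := abs_add_le ((y s).1 - (x s).1) ((x s).1 - Real.pi)
      rw [sub_add_sub_cancel] at this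
      linarith [hxr s]
    have h2 := abs_pendulumRemainder_sub_le a (F s) h1 ((hxr s).trans (by linarith))
    rw [sub_sub_sub_cancel_right] at h2
    exact h2.trans (mul_le_mul_of_nonneg_right (hF s) (abs_nonneg _))

/-! ### Dependence of the periodic solution on the parameter -/

/-- Families of weakly nonlinear damped oscillators `u'' + m u' + k u = N c t u` with right-hand side
of period `T` in `t` have periodic solutions that are Lipschitz in the parameter `c`. -/
theorem exists_periodic_solution_family {T m k : ℝ} (hT : 0 < T) (hm : 0 < m) (hk : 0 < k) :
    ∃ ρ > 0, ∀ (S : Set ℝ) (N : ℝ → ℝ → ℝ → ℝ) (r q M : ℝ), 0 ≤ q → q ≤ ρ → 0 ≤ r → 0 ≤ M →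
      (∀ c, Continuous fun z : ℝ × ℝ => N c z.1 z.2) → (∀ c t u, N c (t + T) u = N c t u) →
      (∀ c ∈ S, ∀ t u v, |u| ≤ r → |v| ≤ r → |N c t u - N c t v| ≤ q * |u - v|) →
      (∀ c d t u, |N c t u - N d t u| ≤ M * |c - d|) →
      (∀ c ∈ S, ∀ t, |N c t 0| ≤ ρ * r) →
      ∃ u p : ℝ → ℝ → ℝ, ∃ K : ℝ, 0 ≤ K ∧
        (∀ c ∈ S, Function.Periodic (u c) T ∧ Function.Periodic (p c) T ∧ (∀ t, |u c t| ≤ r) ∧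
          (∀ t, HasDerivAt (u c) (p c t) t) ∧
          (∀ t, HasDerivAt (p c) (-k * u c t - m * p c t + N c t (u c t)) t)) ∧
        (∀ c ∈ S, ∀ d ∈ S, ∀ t,
          |u c t - u d t| ≤ K * |c - d| ∧ |p c t - p d t| ≤ K * |c - d|) ∧
        (∀ c ∈ S, (∀ t, N c t 0 = 0) → ∀ t, u c t = 0 ∧ p c t = 0) := by
  obtain ⟨C, hC, U, P, hU0, hP0, hUP, hLip⟩ := exists_periodic_solution_operator hT hm hk
  refine ⟨1 / (2 * C), by positivity,
    fun S N r q M hq0 hq hr0 hM0 hcomp hNp hNL hNc hN0 => ?_⟩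
  have hCq : C * q ≤ 1 / 2 := by
    rw [le_div_iff₀ (by positivity)] at hq
    linarith
  have hUc : ∀ g, Continuous g → Function.Periodic g T → Continuous (U g) :=
    fun g hg hp => continuous_iff_continuousAt.mpr fun t => ((hUP g hg hp).2.2.1 t).continuousAt
  have hex : ∀ c, ∃ u : BoundedContinuousFunction ℝ ℝ, c ∈ S →
      Function.Periodic u T ∧ (∀ t, |u t| ≤ r) ∧ ∀ t, U (fun s => N c s (u s)) t = u t := by
    intro c
    by_cases hc : c ∈ S
    · obtain ⟨u, hu⟩ := exists_periodic_fixedPoint hq0 hr0 hU0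
        (fun g hg hp => ⟨hUc g hg hp, (hUP g hg hp).1⟩)
        (fun g h hg hh hgp hhp M hM t => (hLip g h hg hh hgp hhp M hM t).1)
        (hcomp c) (hNp c) (hNL c hc) (hN0 c hc) hCq (le_of_eq (by field_simp))
      exact ⟨u, fun _ => hu⟩
    · exact ⟨0, fun h => absurd h hc⟩
  choose u hu using hex
  let g : ℝ → ℝ → ℝ := fun c s => N c s (u c s)
  have hgc : ∀ c, Continuous (g c) := fun c =>
    (hcomp c).comp (continuous_id.prodMk (u c).continuous)
  have hgp : ∀ c ∈ S, Function.Periodic (g c) T := fun c hc s => by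
    simp only [g, hNp, (hu c hc).1 s]
  have hUu : ∀ c ∈ S, U (g c) = u c := fun c hc => funext (hu c hc).2.2
  have hcontr : ∀ c d, C * (q * dist (u c) (u d)) ≤ dist (u c) (u d) / 2 := fun c d => by
    have h := mul_le_mul_of_nonneg_right hCq (dist_nonneg (x := u c) (y := u d))
    linarith
  have hgd : ∀ c ∈ S, ∀ d ∈ S, ∀ t,
      |g c t - g d t| ≤ q * dist (u c) (u d) + M * |c - d| := by
    intro c hc d hd t
    have h1 := hNL c hc t (u c t) (u d t) ((hu c hc).2.1 t) ((hu d hd).2.1 t)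
    have h3 : |u c t - u d t| ≤ dist (u c) (u d) :=
      (Real.dist_eq _ _).symm.trans_le (BoundedContinuousFunction.dist_coe_le_dist t)
    have h4 := mul_le_mul_of_nonneg_left h3 hq0
    have h6 := abs_sub_le (g c t) (N c t (u d t)) (g d t)
    linarith [hNc c d t (u d t)]
  have hud : ∀ c ∈ S, ∀ d ∈ S, dist (u c) (u d) ≤ 2 * C * M * |c - d| := by
    intro c hc d hd
    -- As `C * q ≤ 1 / 2`, half of the distance is absorbed on the left.
    have h : dist (u c) (u d) ≤ C * (q * dist (u c) (u d) + M * |c - d|) := by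
      rw [BoundedContinuousFunction.dist_le (by positivity)]
      intro t
      have h1 := (hLip (g c) (g d) (hgc c) (hgc d) (hgp c hc) (hgp d hd) _
        (hgd c hc d hd) t).1
      rwa [hUu c hc, hUu d hd, ← Real.dist_eq] at h1
    linarith [hcontr c d]
  refine ⟨fun c => u c, fun c => P (g c), 2 * C * M, by positivity, fun c hc => ?_,
    fun c hc d hd t => ⟨?_, ?_⟩, fun c hc h0 => ?_⟩
  · have h := hUP _ (hgc c) (hgp c hc)
    rw [hUu c hc] at h
    exact ⟨h.1, h.2.1, (hu c hc).2.1, h.2.2.1, h.2.2.2⟩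
  · exact ((Real.dist_eq _ _).symm.trans_le
      (BoundedContinuousFunction.dist_coe_le_dist t)).trans (hud c hc d hd)
  · have h1 := (hLip (g c) (g d) (hgc c) (hgc d) (hgp c hc) (hgp d hd) _ (hgd c hc d hd) t).2
    linarith [hud c hc d hd, hcontr c d]
  · have hnorm : ∀ t, |u c t| ≤ ‖u c‖ := fun t => (u c).norm_coe_le_norm t
    -- Since `C * q ≤ 1 / 2`, this forces `u c = 0`.
    have h : ‖u c‖ ≤ C * (q * ‖u c‖) := by
      rw [BoundedContinuousFunction.norm_le (by positivity)]
      intro t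
      have h1 := (hLip (g c) 0 (hgc c) continuous_const (hgp c hc) (fun _ => rfl)
        (q * ‖u c‖) (fun s => ?_) t).1
      · rwa [hUu c hc, hU0, sub_zero] at h1
      · have h2 := hNL c hc s (u c s) 0 ((hu c hc).2.1 s) (by simpa using hr0)
        rw [h0, sub_zero, sub_zero] at h2
        rw [Pi.zero_apply, sub_zero]
        exact h2.trans (mul_le_mul_of_nonneg_left (hnorm s) hq0)
    have h2 := mul_le_mul_of_nonneg_right hCq (norm_nonneg (u c))
    have hu0 : ∀ t, u c t = 0 := fun t => abs_nonpos_iff.mp ((hnorm t).trans (by linarith))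
    have hg0 : g c = 0 := funext fun s => by simp only [g, hu0, h0, Pi.zero_apply]
    exact fun t => ⟨hu0 t, by simp only [hg0, hP0]⟩

/-! ### Choice of constants and conclusion -/

theorem proposition1 (a μ : ℝ) (f : ℝ → ℝ) (hf : Continuous f)
    (hper : Function.Periodic f (2 * Real.pi)) (hμ : 0 < μ) (ha : 2 < a ^ 2) :
    ∃ c₀ > 0, ∃ x : ℝ → ℝ → ℝ × ℝ,
      (∀ t, x 0 t = (Real.pi, 0)) ∧
      ContinuousOn (fun q : ℝ × ℝ => x q.1 q.2) (Ico 0 c₀ ×ˢ univ) ∧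
      ∀ c ∈ Ico 0 c₀,
        Function.Periodic (x c) (2 * Real.pi) ∧
        IsAsymptoticallyStableSolution (averagedPendulum a μ (fun t => c * f t)) (x c) := by
  have hk : 0 < a ^ 2 / 2 - 1 := by linarith
  obtain ⟨η, hη, hstable⟩ := exists_averagedPendulum_stable hμ ha
  obtain ⟨ρ, hρ, hfamily⟩ := exists_periodic_solution_family Real.two_pi_pos hμ hk
  obtain ⟨M, hM0, hM⟩ : ∃ M > 0, ∀ t, |f t| ≤ M := by
    obtain ⟨M, hM0, hM⟩ :=
      (hper.isBounded_of_continuous Real.two_pi_pos.ne' hf).exists_pos_norm_le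
    exact ⟨M, hM0, fun t => hM _ (mem_range_self t)⟩
  obtain ⟨q, hq0, hqη, hqρ⟩ : ∃ q > 0, q ≤ η ∧ q ≤ ρ :=
    ⟨min η ρ, lt_min hη hρ, min_le_left _ _, min_le_right _ _⟩
  -- Half of the Lipschitz budget `q` goes to the radius, half to the force; `c₀ * M ≤ ρ * r`
  -- moreover keeps the fixed point in the ball.
  obtain ⟨r, hr0, hrq⟩ : ∃ r > 0, (1 + a ^ 2) * (2 * r) = q / 2 :=
    ⟨q / (4 * (1 + a ^ 2)), by positivity, by field_simp; norm_num⟩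
  obtain ⟨c₀, hc₀, hcq, hcρ⟩ : ∃ c₀ > 0, c₀ * M ≤ q / 2 ∧ c₀ * M ≤ ρ * r :=
    ⟨min (q / 2) (ρ * r) / M, by positivity, (div_mul_cancel₀ _ hM0.ne').trans_le (min_le_left _ _),
      (div_mul_cancel₀ _ hM0.ne').trans_le (min_le_right _ _)⟩
  have hcf : ∀ c ∈ Ico 0 c₀, ∀ t, |c * f t| ≤ c₀ * M := fun c hc t => by
    rw [abs_mul, abs_of_nonneg hc.1]
    exact mul_le_mul hc.2.le (hM t) (abs_nonneg _) hc₀.le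
  have hsmall : ∀ c ∈ Ico 0 c₀, ∀ t, (1 + a ^ 2) * (2 * r) + |c * f t| ≤ q := fun c hc t => by
    linarith [hcf c hc t]
  obtain ⟨u, p, K, hK, hup, hLip, hzero⟩ := hfamily (Ico 0 c₀)
    (fun c t u => pendulumRemainder a (c * f t) u) r q M hq0.le hqρ hr0.le hM0.le
    (fun c => (continuous_pendulumRemainder a).comp
      ((continuous_const.mul (hf.comp continuous_fst)).prodMk continuous_snd))
    (fun c t u => by simp only [hper t])
    (fun c hc t u v hu hv => (abs_pendulumRemainder_sub_le a (c * f t)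
      (hu.trans (by linarith : r ≤ 2 * r)) (hv.trans (by linarith))).trans
        (mul_le_mul_of_nonneg_right (hsmall c hc t) (abs_nonneg _)))
    (fun c d t u => by
      refine (abs_pendulumRemainder_sub_force_le a (c * f t) (d * f t) u).trans ?_
      rw [← sub_mul, abs_mul, mul_comm]
      exact mul_le_mul_of_nonneg_right (hM t) (abs_nonneg _))
    (fun c hc t => by
      rw [pendulumRemainder_zero, abs_neg]
      exact (hcf c hc t).trans hcρ)
  refine ⟨c₀, hc₀, fun c t => (Real.pi + u c t, p c t), fun t => ?_, ?_,
    fun c hc => ⟨fun t => ?_, ?_⟩⟩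
  · have h := hzero 0 ⟨le_rfl, hc₀⟩ (fun t => by simp [pendulumRemainder_zero]) t
    simp [h.1, h.2]
  -- Joint continuity follows from continuity in `t` and a Lipschitz bound in `c` uniform in `t`.
  · refine continuousOn_prod_of_continuousOn_lipschitzOnWith _ (Real.toNNReal K)
      (fun c hc => ?_) fun t _ => LipschitzOnWith.of_dist_le_mul fun c hc d hd => ?_
    · exact continuousOn_of_forall_continuousAt fun t _ =>
        (continuousAt_const.add ((hup c hc).2.2.2.1 t).continuousAt).prodMk
          ((hup c hc).2.2.2.2 t).continuousAt
    · rw [Real.coe_toNNReal _ hK, Prod.dist_eq, Real.dist_eq c d]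
      refine max_le ?_ ((Real.dist_eq _ _).trans_le (hLip c hc d hd t).2)
      simp only [dist_add_left]
      exact (Real.dist_eq _ _).trans_le (hLip c hc d hd t).1
  · simp only [(hup c hc).1 t, (hup c hc).2.1 t]
  · refine hstable r hr0 _ _ (fun t => (hsmall c hc t).trans hqη)
      (fun t => by simpa using (hup c hc).2.2.1 t) fun t => ?_
    refine (((hup c hc).2.2.2.1 t).const_add Real.pi).prodMk
      ((hup c hc).2.2.2.2 t) |>.congr_deriv ?_
    rw [averagedPendulum_eq]
    simp
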